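/- Let $R_{-2}=(-1,-\tfrac12)\times(-\tfrac12,\tfrac12)$ and $R_{-1}=(-\tfrac12,0)\times(-\tfrac12,\tfrac12)$, and let $R=(-1,0)\times(-\tfrac12,\tfrac12)$ be the open rectangle formed by $R_{-2}$, $R_{-1}$ and their common open edge. For $M\in\mathbb{R}$ and $u\in W^{1,2}(R;\mathbb{R}^2)$ put $$E_M(u)=\int_{R_{-2}}\bigl(|\nabla u|^2-M\det\nabla u\bigr)\,dx+\int_{R_{-1}}|\nabla u|^2\,dx,$$ where $|A|^2=\sum_{i,j}A_{ij}^2$. Let $\mathcal U_0$ be the set of all $u\in W^{1,2}(R;\mathbb{R}^2)$ such that $u=0$ on $\partial R_{-2}\setminus\{x:\ x_1=-\tfrac12\}$ in the sense of traces (no condition is imposed on the rest of $\partial R$). If $0\le M<4$, then $$E_M(u)\ \ge\ \frac{4-M}{4}\int_R|\nabla u|^2\,dx\qquad\text{for every }u\in\mathcal U_0 .$$ In particular, $E_M$ is mean coercive on $\mathcal U_0$: there is $\gamma>0$ such that $E_M(u)\ge\gamma\int_R|\nabla u|^2\,dx$ for every $u\in\mathcal U_0$. -/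

import Mathlib

open MeasureTheory Filter Topology
open scoped ContDiff ENNReal

noncomputable section

namespace Insulation

/-- The Euclidean plane. Its coordinates `x₁, x₂` are `x 0, x 1`. -/
abbrev Plane : Type := EuclideanSpace ℝ (Fin 2)

/-- The open rectangle `(a, b) × (c, d)`. -/
def rect (a b c d : ℝ) : Set Plane :=
  {x | x 0 ∈ Set.Ioo a b ∧ x 1 ∈ Set.Ioo c d}

/-- `R₋₂ = (-1, -1/2) × (-1/2, 1/2)`. -/
def Rm2 : Set Plane := rect (-1) (-1 / 2) (-1 / 2) (1 / 2)

/-- `R₋₁ = (-1/2, 0) × (-1/2, 1/2)`. -/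
def Rm1 : Set Plane := rect (-1 / 2) 0 (-1 / 2) (1 / 2)

/-- `R = (-1, 0) × (-1/2, 1/2)`, the rectangle formed by `R₋₂` and `R₋₁` together with their
common open edge (so that Sobolev functions on `R` do not jump across that edge). -/
def R : Set Plane := rect (-1) 0 (-1 / 2) (1 / 2)

/-- The partial derivative `∂ⱼ f (x)`. -/
def pderiv (f : Plane → ℝ) (j : Fin 2) (x : Plane) : ℝ :=
  fderiv ℝ f x (EuclideanSpace.single j 1)

/-- `G` is a weak gradient of `u` on `Ω`: `G i j` is the weak derivative `∂ⱼ uᵢ`. -/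
def IsWeakGradient (Ω : Set Plane) (u : Plane → Plane)
    (G : Plane → Matrix (Fin 2) (Fin 2) ℝ) : Prop :=
  ∀ (i j : Fin 2) (η : Plane → ℝ), ContDiff ℝ ∞ η → HasCompactSupport η → tsupport η ⊆ Ω →
    ∫ x in Ω, u x i * pderiv η j x = - ∫ x in Ω, G x i j * η x

/-- A function of the Sobolev space `W^{1,2}(Ω; ℝ²)`, together with (a representative of) its weak
gradient. -/
structure W12 (Ω : Set Plane) where
  /-- the function -/
  val : Plane → Plane
  /-- its weak gradient -/
  grad : Plane → Matrix (Fin 2) (Fin 2) ℝ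
  memLp_val : MemLp val 2 (volume.restrict Ω)
  memLp_grad : ∀ i j, MemLp (fun x => grad x i j) 2 (volume.restrict Ω)
  isWeakGradient : IsWeakGradient Ω val grad

/-- `g ∈ L²(Γ)` is the trace of `u ∈ W^{1,2}(Ω; ℝ²)` on the boundary piece `Γ` (with respect to
arc length, i.e. the one-dimensional Hausdorff measure): `g` is the `L²(Γ)`-limit of the boundary
values of smooth functions (on the whole plane) that converge to `u` in `W^{1,2}(Ω; ℝ²)`. -/
def HasTrace {Ω : Set Plane} (u : W12 Ω) (Γ : Set Plane) (g : Plane → Plane) : Prop :=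
  MemLp g 2 ((Measure.hausdorffMeasure 1).restrict Γ) ∧
  ∃ v : ℕ → Plane → Plane,
    (∀ n, ContDiff ℝ ∞ (v n)) ∧
    Tendsto (fun n => eLpNorm (fun x => v n x - u.val x) 2 (volume.restrict Ω)) atTop (𝓝 0) ∧
    (∀ i j, Tendsto
      (fun n => eLpNorm (fun x => pderiv (fun y => v n y i) j x - u.grad x i j) 2
        (volume.restrict Ω)) atTop (𝓝 0)) ∧
    Tendsto (fun n => eLpNorm (fun x => v n x - g x) 2
      ((Measure.hausdorffMeasure 1).restrict Γ)) atTop (𝓝 0)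

/-- The squared Frobenius norm `|A|²`. -/
def normSq (A : Matrix (Fin 2) (Fin 2) ℝ) : ℝ := ∑ i, ∑ j, A i j ^ 2

/-- `∂R₋₂ \ {x₁ = -1/2}`: the boundary of `R₋₂` without its right-hand edge. -/
def dirichletPart : Set Plane := frontier Rm2 \ {x | x 0 = -1 / 2}

/-- The functions in `W^{1,2}(R; ℝ²)` that vanish on `∂R₋₂ \ {x₁ = -1/2}` in the sense of
traces. -/
def U₀ : Set (W12 R) := {u | HasTrace u dirichletPart 0}

/-- `E_M(u) = ∫_{R₋₂} (|∇u|² - M det ∇u) dx + ∫_{R₋₁} |∇u|² dx`. -/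
def energy (M : ℝ) (u : W12 R) : ℝ :=
  (∫ x in Rm2, (normSq (u.grad x) - M * (u.grad x).det)) + ∫ x in Rm1, normSq (u.grad x)

/-- The Dirichlet energy `∫_R |∇u|² dx`. -/
def dirichlet (u : W12 R) : ℝ := ∫ x in R, normSq (u.grad x)

/-- A functional `I` is mean coercive on a class `U` of functions if `I(u) ≥ γ ∫_R |∇u|²` on `U`
for some `γ > 0`. -/
def MeanCoercive (I : W12 R → ℝ) (U : Set (W12 R)) : Prop :=
  ∃ γ : ℝ, 0 < γ ∧ ∀ u ∈ U, γ * dirichlet u ≤ I u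

end Insulation

end

noncomputable section

namespace Insulation

/-! ### Convergence of `L²` pairings -/

/-! The claim reduces to `4 ∫_{R₋₂} det ∇u ≤ ∫_R |∇u|²` (`four_mul_integral_det_le_dirichlet`),
because `E_M(u)` is the Dirichlet energy minus `M` times the integral of the determinant over `R₋₂`.

Let `ũ` be the reflection of `u|_{R₋₁}` in the common edge. The Jacobian `J(f, g) = ∂₁f ∂₂g - ∂₂f
∂₁g` is a null Lagrangian: its integral over `R₋₂` is a boundary integral of `f` times the
tangential derivative of `g`. With `f = uᵢ` and `g = uₖ - ũₖ` this boundary integral vanishes, since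
`u = 0` on three edges and `u = ũ` on the fourth (`integral_jacobian_sub_reflGrad`). Hence `∫ J(uᵢ,
uₖ) = ∫ J(uᵢ, ũₖ)`, so that `2 ∫ det ∇u = ∫ (J(u₁, ũ₂) - J(u₂, ũ₁)) ≤ ½ ∫_{R₋₂} (|∇u|² + |∇ũ|²) = ½
∫_R |∇u|²`. -/

theorem tendsto_integral_mul_of_tendsto_eLpNorm {α : Type*} [MeasurableSpace α] {μ : Measure α}
    {A : ℕ → α → ℝ} {a b : α → ℝ} (hA : ∀ n, MemLp (A n) 2 μ) (ha : MemLp a 2 μ)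
    (hb : MemLp b 2 μ) (h : Tendsto (fun n => eLpNorm (fun x => A n x - a x) 2 μ) atTop (𝓝 0)) :
    Tendsto (fun n => ∫ x, A n x * b x ∂μ) atTop (𝓝 (∫ x, a x * b x ∂μ)) := by
  refine tendsto_integral_of_L1' _ (ha.1.mul hb.1)
    (Eventually.of_forall fun n => (hA n).integrable_mul hb) ?_
  have hlim : Tendsto (fun n => eLpNorm (fun x => A n x - a x) 2 μ * eLpNorm b 2 μ) atTop
      (𝓝 0) := by
    simpa using ENNReal.Tendsto.mul_const h (Or.inr hb.eLpNorm_ne_top)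
  refine tendsto_of_tendsto_of_tendsto_of_le_of_le tendsto_const_nhds hlim
    (fun _ => zero_le) fun n => ?_
  have := eLpNorm_smul_le_mul_eLpNorm (p := 2) (q := 2) (r := 1) hb.1 ((hA n).sub ha).1
  refine le_trans (le_of_eq ?_) this
  congr 1
  ext x
  simp [sub_mul]

/-! ### Calculus on the plane -/

/-- The identification of `ℝ × ℝ` with the Euclidean plane. -/
def mk : (ℝ × ℝ) ≃L[ℝ] Plane :=
  (ContinuousLinearEquiv.finTwoArrow ℝ ℝ).symm.trans (EuclideanSpace.equiv (Fin 2) ℝ).symm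

@[simp] theorem mk_apply_zero (p : ℝ × ℝ) : mk p 0 = p.1 := rfl

@[simp] theorem mk_apply_one (p : ℝ × ℝ) : mk p 1 = p.2 := rfl

theorem mk_eta (x : Plane) : mk (x 0, x 1) = x := by
  ext i; fin_cases i <;> rfl

theorem mk_one_zero : mk (1, 0) = EuclideanSpace.single 0 1 := by
  ext i; fin_cases i <;> simp [mk]

theorem mk_zero_one : mk (0, 1) = EuclideanSpace.single 1 1 := by
  ext i; fin_cases i <;> simp [mk]

theorem measurePreserving_mk : MeasurePreserving mk :=
  (PiLp.volume_preserving_toLp (Fin 2)).comp (volume_preserving_finTwoArrow ℝ).symm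

theorem measurableEmbedding_mk : MeasurableEmbedding mk :=
  mk.toHomeomorph.measurableEmbedding

theorem mk_preimage_rect (a b c d : ℝ) :
    mk ⁻¹' rect a b c d = Set.Ioo a b ×ˢ Set.Ioo c d := rfl

theorem isOpen_rect (a b c d : ℝ) : IsOpen (rect a b c d) := by
  have h0 : Continuous fun x : Plane => x 0 := by fun_prop
  have h1 : Continuous fun x : Plane => x 1 := by fun_prop
  exact (isOpen_Ioo.preimage h0).inter (isOpen_Ioo.preimage h1)

theorem measurableSet_rect (a b c d : ℝ) : MeasurableSet (rect a b c d) :=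
  (isOpen_rect a b c d).measurableSet

theorem rect_subset_image (a b c d : ℝ) :
    rect a b c d ⊆ mk '' (Set.Icc a b ×ˢ Set.Icc c d) := fun x hx =>
  ⟨(x 0, x 1), ⟨Set.Ioo_subset_Icc_self hx.1, Set.Ioo_subset_Icc_self hx.2⟩, mk_eta x⟩

theorem memLp_rect {f : Plane → ℝ} (hf : Continuous f) (p : ℝ≥0∞) (a b c d : ℝ) :
    MemLp f p (volume.restrict (rect a b c d)) := by
  have hK : IsCompact (mk '' (Set.Icc a b ×ˢ Set.Icc c d)) :=
    (isCompact_Icc.prod isCompact_Icc).image mk.continuous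
  refine MemLp.mono_measure (Measure.restrict_mono (rect_subset_image a b c d) le_rfl) ?_
  obtain ⟨C, hC⟩ := hK.exists_bound_of_continuousOn hf.continuousOn
  have : IsFiniteMeasure (volume.restrict (mk '' (Set.Icc a b ×ˢ Set.Icc c d))) :=
    ⟨by simpa using hK.measure_lt_top⟩
  refine MemLp.of_bound hf.aestronglyMeasurable C ?_
  exact (ae_restrict_mem hK.measurableSet).mono fun x hx => hC x hx

theorem setIntegral_rect {f : Plane → ℝ} (hf : Continuous f) {a b c d : ℝ} (hab : a ≤ b)
    (hcd : c ≤ d) :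
    ∫ x in rect a b c d, f x = ∫ s in a..b, ∫ t in c..d, f (mk (s, t)) := by
  rw [← measurePreserving_mk.setIntegral_preimage_emb measurableEmbedding_mk, mk_preimage_rect,
    Measure.volume_eq_prod, setIntegral_prod, intervalIntegral.integral_of_le hab,
    integral_Ioc_eq_integral_Ioo]
  · simp_rw [intervalIntegral.integral_of_le hcd, integral_Ioc_eq_integral_Ioo]
  · have : IntegrableOn (fun p => f (mk p)) (Set.Icc a b ×ˢ Set.Icc c d) volume :=
      (hf.comp mk.continuous).continuousOn.integrableOn_compact
        (isCompact_Icc.prod isCompact_Icc)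
    exact this.mono_set (Set.prod_mono Set.Ioo_subset_Icc_self Set.Ioo_subset_Icc_self)

theorem contDiff_pderiv {f : Plane → ℝ} (hf : ContDiff ℝ ∞ f) (j : Fin 2) :
    ContDiff ℝ ∞ (pderiv f j) :=
  (hf.fderiv_right (m := ∞) (by simp)).clm_apply contDiff_const

theorem pderiv_mul {f g : Plane → ℝ} {x : Plane} (hf : DifferentiableAt ℝ f x)
    (hg : DifferentiableAt ℝ g x) (j : Fin 2) :
    pderiv (fun y => f y * g y) j x = f x * pderiv g j x + g x * pderiv f j x := by
  simp [pderiv, fderiv_fun_mul hf hg]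

theorem pderiv_comm {f : Plane → ℝ} (hf : ContDiff ℝ ∞ f) (i j : Fin 2) (x : Plane) :
    pderiv (pderiv f i) j x = pderiv (pderiv f j) i x := by
  have hd : DifferentiableAt ℝ (fderiv ℝ f) x :=
    ((hf.fderiv_right (m := ∞) (by simp)).differentiable (by simp)) x
  have key (v w : Plane) : fderiv ℝ (fun y => fderiv ℝ f y v) x w
      = fderiv ℝ (fderiv ℝ f) x w v := by
    rw [fderiv_clm_apply hd (differentiableAt_const v)]
    simp
  have hsymm : IsSymmSndFDerivAt ℝ f x :=
    hf.contDiffAt.isSymmSndFDerivAt (by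
      rw [minSmoothness_of_isRCLikeNormedField]
      exact WithTop.coe_le_coe.2 (le_top : (2 : ℕ∞) ≤ ⊤))
  unfold pderiv
  rw [key, key]
  exact hsymm _ _

theorem integral_rect_divergence {A B : Plane → ℝ} (hA : ContDiff ℝ ∞ A) (hB : ContDiff ℝ ∞ B)
    {a b c d : ℝ} (hab : a ≤ b) (hcd : c ≤ d) :
    ∫ x in rect a b c d, (pderiv A 0 x + pderiv B 1 x) =
      (((∫ s in a..b, B (mk (s, d))) - ∫ s in a..b, B (mk (s, c))) +
        ∫ t in c..d, A (mk (b, t))) - ∫ t in c..d, A (mk (a, t)) := by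
  have hcA := (contDiff_pderiv hA 0).continuous
  have hcB := (contDiff_pderiv hB 1).continuous
  have hd {F : Plane → ℝ} (hF : ContDiff ℝ ∞ F) (p : ℝ × ℝ) :
      HasFDerivAt (fun q => F (mk q)) ((fderiv ℝ F (mk p)).comp (mk : ℝ × ℝ →L[ℝ] Plane)) p :=
    ((hF.differentiable (by simp)) (mk p)).hasFDerivAt.comp p mk.hasFDerivAt
  have h := integral2_divergence_prod_of_hasFDerivAt (fun p => A (mk p)) (fun p => B (mk p))
    (fun p => (fderiv ℝ A (mk p)).comp (mk : ℝ × ℝ →L[ℝ] Plane))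
    (fun p => (fderiv ℝ B (mk p)).comp (mk : ℝ × ℝ →L[ℝ] Plane)) a c b d
    (hA.continuous.comp mk.continuous).continuousOn
    (hB.continuous.comp mk.continuous).continuousOn
    (fun p _ => hd hA p) (fun p _ => hd hB p)
  simp only [ContinuousLinearMap.comp_apply, ContinuousLinearEquiv.coe_coe, mk_one_zero,
    mk_zero_one] at h
  refine (setIntegral_rect (hcA.add hcB) hab hcd).trans ?_
  exact h (((hcA.add hcB).comp mk.continuous).continuousOn.integrableOn_compact
    (isCompact_uIcc.prod isCompact_uIcc))

/-- Integrating the Jacobian `∂₁f ∂₂g - ∂₂f ∂₁g` over a rectangle, for a function `g` that vanishes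
on the line through the right-hand edge. -/
theorem integral_rect_jacobian {f g : Plane → ℝ} (hf : ContDiff ℝ ∞ f) (hg : ContDiff ℝ ∞ g)
    {a b c d : ℝ} (hab : a ≤ b) (hcd : c ≤ d) (hgb : ∀ t, g (mk (b, t)) = 0) :
    ∫ x in rect a b c d, (pderiv f 0 x * pderiv g 1 x - pderiv f 1 x * pderiv g 0 x) =
      (∫ s in a..b, f (mk (s, c)) * pderiv g 0 (mk (s, c)))
        - (∫ s in a..b, f (mk (s, d)) * pderiv g 0 (mk (s, d)))
        - ∫ t in c..d, f (mk (a, t)) * pderiv g 1 (mk (a, t)) := by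
  have hg0 := contDiff_pderiv hg 0
  have hg1 := contDiff_pderiv hg 1
  -- On the right edge `∂₂` is tangential, so it annihilates a function that is constant there.
  have hedge (t : ℝ) : pderiv g 1 (mk (b, t)) = 0 := by
    have hγ : HasDerivAt (fun s : ℝ => (b, s)) ((0 : ℝ), (1 : ℝ)) t :=
      (hasDerivAt_const t b).prodMk (hasDerivAt_id t)
    have hmk : HasDerivAt (fun s : ℝ => mk (b, s)) (mk (0, 1)) t :=
      (mk : ℝ × ℝ →L[ℝ] Plane).hasFDerivAt.comp_hasDerivAt t hγ
    have := ((hg.differentiable (by simp)) (mk (b, t))).hasFDerivAt.comp_hasDerivAt t hmk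
    rw [mk_zero_one] at this
    refine this.unique ?_
    have h0 : (g ∘ fun s : ℝ => mk (b, s)) = fun _ => 0 := funext hgb
    rw [h0]
    exact hasDerivAt_const t 0
  -- The Jacobian is the divergence of `(f ∂₂g, -f ∂₁g)`; the second derivatives of `g` cancel by
  -- symmetry.
  have h := integral_rect_divergence (hf.mul hg1) (hf.mul hg0).neg hab hcd
  have hneg (x : Plane) : pderiv (fun y => -(f y * pderiv g 0 y)) 1 x
      = -pderiv (fun y => f y * pderiv g 0 y) 1 x := by
    simp [pderiv, fderiv_fun_neg]
  have hcongr (x : Plane) :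
      pderiv (fun y => f y * pderiv g 1 y) 0 x + pderiv (fun y => -(f y * pderiv g 0 y)) 1 x =
        pderiv f 0 x * pderiv g 1 x - pderiv f 1 x * pderiv g 0 x := by
    have hfx := hf.differentiable (by simp) x
    rw [hneg, pderiv_mul hfx (hg1.differentiable (by simp) x),
      pderiv_mul hfx (hg0.differentiable (by simp) x), pderiv_comm hg 1 0]
    ring
  simp only [hcongr, hedge, mul_zero, intervalIntegral.integral_zero,
    intervalIntegral.integral_neg] at h
  rw [h]
  ring

/-! ### Boundary integrals and traces -/

/-- Passes from the Hausdorff measure in the trace condition to the interval integrals over edges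
produced by the divergence theorem. -/
theorem tendsto_integral_mul_of_tendsto_eLpNorm_hausdorffMeasure {Γ : Set Plane}
    (hΓ : MeasurableSet Γ) {γ : ℝ → Plane} (hγ : Isometry γ) {c d : ℝ} (hcd : c ≤ d)
    (hmaps : ∀ t ∈ Set.Ioo c d, γ t ∈ Γ) {f : ℕ → Plane → ℝ} (hf : ∀ n, Continuous (f n))
    (h : Tendsto (fun n => eLpNorm (f n) 2 ((Measure.hausdorffMeasure 1).restrict Γ)) atTop (𝓝 0))
    {k : ℝ → ℝ} (hk : Continuous k) :
    Tendsto (fun n => ∫ t in c..d, f n (γ t) * k t) atTop (𝓝 0) := by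
  have hmem {φ : ℝ → ℝ} (hφ : Continuous φ) : MemLp φ 2 (volume.restrict (Set.Ioo c d)) := by
    obtain ⟨C, hC⟩ := isCompact_Icc.exists_bound_of_continuousOn (s := Set.Icc c d) hφ.continuousOn
    refine MemLp.of_bound hφ.aestronglyMeasurable C ?_
    exact (ae_restrict_mem measurableSet_Ioo).mono fun x hx =>
      hC x (Set.Ioo_subset_Icc_self hx)
  -- An isometry carries one-dimensional Hausdorff measure, which is Lebesgue measure on the line,
  -- to Hausdorff measure on its range.
  have hle : (volume.restrict (Set.Ioo c d)).map γ ≤ (Measure.hausdorffMeasure 1).restrict Γ := by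
    have h1 : (volume.restrict (Set.Ioo c d)).map γ ≤ (volume.restrict (γ ⁻¹' Γ)).map γ :=
      Measure.map_mono (Measure.restrict_mono hmaps le_rfl) hγ.continuous.measurable
    refine h1.trans ?_
    rw [← Measure.restrict_map hγ.continuous.measurable hΓ, ← hausdorffMeasure_real,
      hγ.map_hausdorffMeasure (Or.inl zero_le_one)]
    exact Measure.restrict_mono_measure Measure.restrict_le_self _
  have hL2 : Tendsto (fun n => eLpNorm (fun t => f n (γ t) - 0) 2 (volume.restrict (Set.Ioo c d)))
      atTop (𝓝 0) := by
    refine tendsto_of_tendsto_of_tendsto_of_le_of_le tendsto_const_nhds h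
      (fun _ => zero_le) fun n => ?_
    simp only [sub_zero]
    calc eLpNorm (fun t => f n (γ t)) 2 (volume.restrict (Set.Ioo c d))
        = eLpNorm (f n) 2 ((volume.restrict (Set.Ioo c d)).map γ) :=
          (eLpNorm_map_measure (hf n).aestronglyMeasurable
            hγ.continuous.measurable.aemeasurable).symm
      _ ≤ _ := eLpNorm_mono_measure _ hle
  have := tendsto_integral_mul_of_tendsto_eLpNorm
    (fun n => hmem ((hf n).comp hγ.continuous)) MemLp.zero' (hmem hk) hL2
  simpa [intervalIntegral.integral_of_le hcd, integral_Ioc_eq_integral_Ioo] using this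

theorem isometry_mk_left (a : ℝ) : Isometry fun t : ℝ => mk (a, t) :=
  Isometry.of_dist_eq fun s t => by
    simp [EuclideanSpace.dist_eq, Fin.sum_univ_two, Real.sqrt_sq dist_nonneg]

theorem isometry_mk_right (c : ℝ) : Isometry fun s : ℝ => mk (s, c) :=
  Isometry.of_dist_eq fun s t => by
    simp [EuclideanSpace.dist_eq, Fin.sum_univ_two, Real.sqrt_sq dist_nonneg]

theorem measurableSet_dirichletPart : MeasurableSet dirichletPart := by
  have h0 : Continuous fun x : Plane => x 0 := by fun_prop
  exact isClosed_frontier.measurableSet.diff (isClosed_singleton.preimage h0).measurableSet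

theorem mk_mem_dirichletPart {s t : ℝ} (hs : s ∈ Set.Ico (-1) (-1 / 2))
    (ht : t ∈ Set.Icc (-1 / 2) (1 / 2)) (h : s = -1 ∨ t = -1 / 2 ∨ t = 1 / 2) :
    mk (s, t) ∈ dirichletPart := by
  refine ⟨?_, fun h' => hs.2.ne h'⟩
  rw [Rm2, (isOpen_rect _ _ _ _).frontier_eq]
  constructor
  · refine map_mem_closure (s := Set.Ioo (-1) (-1 / 2) ×ˢ Set.Ioo (-1 / 2) (1 / 2)) mk.continuous
      ?_ fun p hp => hp
    rw [closure_prod_eq, closure_Ioo (by norm_num), closure_Ioo (by norm_num)]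
    exact ⟨Set.Ico_subset_Icc_self hs, ht⟩
  · rintro ⟨h0, h1⟩
    simp only [mk_apply_zero, mk_apply_one, Set.mem_Ioo] at h0 h1
    rcases h with h | h | h <;> linarith [h0.1, h1.1, h1.2]

/-- A limit of smooth gradients whose boundary values tend to zero on the Dirichlet part is
orthogonal to the rotated gradients of smooth functions vanishing on the remaining edge. -/
theorem integral_jacobian_eq_zero_of_contDiff {f : ℕ → Plane → ℝ} {F : Fin 2 → Plane → ℝ}
    {g : Plane → ℝ} (hf : ∀ n, ContDiff ℝ ∞ (f n)) (hg : ContDiff ℝ ∞ g)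
    (hF : ∀ j, MemLp (F j) 2 (volume.restrict Rm2))
    (hlim : ∀ j, Tendsto (fun n => eLpNorm (fun x => pderiv (f n) j x - F j x) 2
      (volume.restrict Rm2)) atTop (𝓝 0))
    (htr : Tendsto (fun n => eLpNorm (f n) 2 ((Measure.hausdorffMeasure 1).restrict dirichletPart))
      atTop (𝓝 0))
    (hg0 : ∀ t, g (mk (-1 / 2, t)) = 0) :
    (∫ x in Rm2, F 0 x * pderiv g 1 x) - ∫ x in Rm2, F 1 x * pderiv g 0 x = 0 := by
  have hmem {φ : Plane → ℝ} (hφ : ContDiff ℝ ∞ φ) (j : Fin 2) :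
      MemLp (pderiv φ j) 2 (volume.restrict Rm2) :=
    memLp_rect (contDiff_pderiv hφ j).continuous _ _ _ _ _
  have hbulk := (tendsto_integral_mul_of_tendsto_eLpNorm (fun n => hmem (hf n) 0) (hF 0)
    (hmem hg 1) (hlim 0)).sub (tendsto_integral_mul_of_tendsto_eLpNorm
      (fun n => hmem (hf n) 1) (hF 1) (hmem hg 0) (hlim 1))
  have hcont (n : ℕ) := (hf n).continuous
  have hbot := tendsto_integral_mul_of_tendsto_eLpNorm_hausdorffMeasure
    measurableSet_dirichletPart (isometry_mk_right (-1 / 2)) (c := -1) (d := -1 / 2) (by norm_num)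
    (fun s hs => mk_mem_dirichletPart (Set.Ioo_subset_Ico_self hs) (by norm_num) (by simp))
    hcont htr ((contDiff_pderiv hg 0).continuous.comp (isometry_mk_right (-1 / 2)).continuous)
  have htop := tendsto_integral_mul_of_tendsto_eLpNorm_hausdorffMeasure
    measurableSet_dirichletPart (isometry_mk_right (1 / 2)) (c := -1) (d := -1 / 2) (by norm_num)
    (fun s hs => mk_mem_dirichletPart (Set.Ioo_subset_Ico_self hs) (by norm_num) (by simp))
    hcont htr ((contDiff_pderiv hg 0).continuous.comp (isometry_mk_right (1 / 2)).continuous)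
  have hleft := tendsto_integral_mul_of_tendsto_eLpNorm_hausdorffMeasure
    measurableSet_dirichletPart (isometry_mk_left (-1)) (c := -1 / 2) (d := 1 / 2) (by norm_num)
    (fun t ht => mk_mem_dirichletPart (by norm_num) (Set.Ioo_subset_Icc_self ht) (by simp))
    hcont htr ((contDiff_pderiv hg 1).continuous.comp (isometry_mk_left (-1)).continuous)
  have hbdry := (hbot.sub htop).sub hleft
  simp only [sub_zero] at hbdry
  -- For each `n` the bulk integrals equal the three edge integrals, which tend to zero because `g`
  -- is fixed.
  refine tendsto_nhds_unique hbulk (hbdry.congr fun n => ?_)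
  exact (integral_rect_jacobian (hf n) hg (by norm_num) (by norm_num) hg0).symm.trans
    (integral_sub ((hmem (hf n) 0).integrable_mul (hmem hg 1))
      ((hmem (hf n) 1).integrable_mul (hmem hg 0)))

/-- The limits are taken one after the other. The derivatives of `g n` on the boundary are not
controlled, so `g n` stays frozen while the boundary values of `f` tend to zero; the remaining bulk
pairing is continuous in `L²`. -/
theorem integral_jacobian_eq_zero {f g : ℕ → Plane → ℝ} {F K : Fin 2 → Plane → ℝ}
    (hf : ∀ n, ContDiff ℝ ∞ (f n)) (hg : ∀ n, ContDiff ℝ ∞ (g n))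
    (hF : ∀ j, MemLp (F j) 2 (volume.restrict Rm2))
    (hK : ∀ j, MemLp (K j) 2 (volume.restrict Rm2))
    (hlim : ∀ j, Tendsto (fun n => eLpNorm (fun x => pderiv (f n) j x - F j x) 2
      (volume.restrict Rm2)) atTop (𝓝 0))
    (hlim' : ∀ j, Tendsto (fun n => eLpNorm (fun x => pderiv (g n) j x - K j x) 2
      (volume.restrict Rm2)) atTop (𝓝 0))
    (htr : Tendsto (fun n => eLpNorm (f n) 2 ((Measure.hausdorffMeasure 1).restrict dirichletPart))
      atTop (𝓝 0))
    (hg0 : ∀ n t, g n (mk (-1 / 2, t)) = 0) :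
    (∫ x in Rm2, F 0 x * K 1 x) - ∫ x in Rm2, F 1 x * K 0 x = 0 := by
  have hmem (n : ℕ) (j : Fin 2) : MemLp (pderiv (g n) j) 2 (volume.restrict Rm2) :=
    memLp_rect (contDiff_pderiv (hg n) j).continuous _ _ _ _ _
  have h := (tendsto_integral_mul_of_tendsto_eLpNorm (fun n => hmem n 1) (hK 1) (hF 0)
    (hlim' 1)).sub (tendsto_integral_mul_of_tendsto_eLpNorm (fun n => hmem n 0) (hK 0) (hF 1)
      (hlim' 0))
  simp only [mul_comm (F _ _)]
  refine tendsto_nhds_unique h (tendsto_const_nhds.congr fun n => ?_)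
  simp only [mul_comm (pderiv (g n) _ _)]
  exact (integral_jacobian_eq_zero_of_contDiff hf (hg n) hF hlim htr (hg0 n)).symm

/-! ### Reflection in the common edge -/

/-- The linear part of the reflection in the line `x₁ = -1/2`. -/
def reflLin : Plane →L[ℝ] Plane :=
  (mk : ℝ × ℝ →L[ℝ] Plane).comp
    (((-ContinuousLinearMap.id ℝ ℝ).prodMap (ContinuousLinearMap.id ℝ ℝ)).comp
      (mk.symm : Plane →L[ℝ] ℝ × ℝ))

/-- The reflection in the line `x₁ = -1/2`. -/
def refl (x : Plane) : Plane := mk (-1 - x 0, x 1)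

theorem refl_eq (x : Plane) : refl x = mk (-1, 0) + reflLin x := by
  have hx : mk.symm x = (x 0, x 1) := by rw [← mk_eta x, mk.symm_apply_apply]; rfl
  simp [refl, reflLin, hx, ← map_add, sub_eq_add_neg]

theorem involutive_refl : Function.Involutive refl := fun x => by
  simp [refl, mk_eta]

theorem hasFDerivAt_refl (x : Plane) : HasFDerivAt refl reflLin x := by
  rw [funext refl_eq]
  exact reflLin.hasFDerivAt.const_add _

theorem contDiff_refl : ContDiff ℝ ∞ refl := by
  rw [funext refl_eq]
  exact contDiff_const.add reflLin.contDiff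

theorem measurableEmbedding_refl : MeasurableEmbedding refl :=
  (Homeomorph.mk involutive_refl.toPerm contDiff_refl.continuous
    contDiff_refl.continuous).measurableEmbedding

theorem measurePreserving_refl : MeasurePreserving refl := by
  have h : MeasurePreserving (Prod.map (fun s : ℝ => -1 - s) (id : ℝ → ℝ)) :=
    (Measure.measurePreserving_sub_left volume (-1 : ℝ)).prod (MeasurePreserving.id volume)
  exact (measurePreserving_mk.comp h).comp
    (measurePreserving_mk.symm mk.toHomeomorph.toMeasurableEquiv)

theorem refl_preimage_Rm1 : refl ⁻¹' Rm1 = Rm2 := by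
  ext x
  simp only [Rm1, Rm2, rect, refl, Set.mem_preimage, Set.mem_ofPred_eq, mk_apply_zero,
    mk_apply_one, Set.mem_Ioo]
  constructor <;> rintro ⟨⟨h1, h2⟩, h3⟩ <;> exact ⟨⟨by linarith, by linarith⟩, h3⟩

theorem measurePreserving_refl_restrict :
    MeasurePreserving refl (volume.restrict Rm2) (volume.restrict Rm1) := by
  rw [← refl_preimage_Rm1]
  exact measurePreserving_refl.restrict_preimage_emb measurableEmbedding_refl Rm1

/-- The sign picked up by the `j`-th partial derivative under reflection. -/
def reflSign : Fin 2 → ℝ := ![-1, 1]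

theorem abs_reflSign (j : Fin 2) : |reflSign j| = 1 := by
  fin_cases j <;> simp [reflSign]

theorem reflLin_single (j : Fin 2) :
    reflLin (EuclideanSpace.single j 1) = reflSign j • EuclideanSpace.single j (1 : ℝ) := by
  fin_cases j
  · change reflLin (EuclideanSpace.single 0 1) = (-1 : ℝ) • EuclideanSpace.single 0 (1 : ℝ)
    rw [← mk_one_zero, ← map_smul]
    simp [reflLin]
  · change reflLin (EuclideanSpace.single 1 1) = (1 : ℝ) • EuclideanSpace.single 1 (1 : ℝ)
    rw [← mk_zero_one, ← map_smul]
    simp [reflLin]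

theorem pderiv_comp_refl {g : Plane → ℝ} (hg : ContDiff ℝ ∞ g) (j : Fin 2) (x : Plane) :
    pderiv (fun y => g (refl y)) j x = reflSign j * pderiv g j (refl x) := by
  have h := (((hg.differentiable (by simp)) (refl x)).hasFDerivAt.comp x
    (hasFDerivAt_refl x)).fderiv
  change fderiv ℝ (g ∘ refl) x _ = _
  rw [h, ContinuousLinearMap.comp_apply, reflLin_single, map_smul]
  rfl

/-! ### The determinant estimate -/

theorem Rm2_subset_R : Rm2 ⊆ R := fun _ hx =>
  ⟨⟨hx.1.1, hx.1.2.trans (by norm_num)⟩, hx.2⟩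

theorem Rm1_subset_R : Rm1 ⊆ R := fun _ hx =>
  ⟨⟨lt_trans (by norm_num) hx.1.1, hx.1.2⟩, hx.2⟩

theorem disjoint_Rm2_Rm1 : Disjoint Rm2 Rm1 :=
  Set.disjoint_left.2 fun _ h h' => lt_asymm h.1.2 h'.1.1

theorem volume_edge : volume {x : Plane | x 0 = -1 / 2} = 0 := by
  have h0 : Continuous fun x : Plane => x 0 := by fun_prop
  have hm : MeasurableSet {x : Plane | x 0 = -1 / 2} :=
    (isClosed_singleton.preimage h0).measurableSet
  have hpre : mk ⁻¹' {x : Plane | x 0 = -1 / 2} = {(-1 / 2 : ℝ)} ×ˢ Set.univ := by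
    ext p
    simp
  rw [← measurePreserving_mk.measure_preimage hm.nullMeasurableSet, hpre,
    Measure.volume_eq_prod, Measure.prod_prod]
  simp

theorem Rm2_union_Rm1_ae_eq : (Rm2 ∪ Rm1 : Set Plane) =ᵐ[volume] R := by
  refine (Set.union_subset Rm2_subset_R Rm1_subset_R).eventuallyLE.antisymm ?_
  refine ae_le_set.2 (measure_mono_null (fun x hx => ?_) volume_edge)
  by_contra hne
  refine hx.2 ?_
  rcases lt_or_gt_of_ne hne with h | h
  · exact Or.inl ⟨⟨hx.1.1.1, h⟩, hx.1.2⟩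
  · exact Or.inr ⟨⟨h, hx.1.1.2⟩, hx.1.2⟩

theorem memLp_grad_Rm2 (u : W12 R) (i j : Fin 2) :
    MemLp (fun x => u.grad x i j) 2 (volume.restrict Rm2) :=
  (u.memLp_grad i j).mono_measure (Measure.restrict_mono Rm2_subset_R le_rfl)

theorem memLp_grad_Rm1 (u : W12 R) (i j : Fin 2) :
    MemLp (fun x => u.grad x i j) 2 (volume.restrict Rm1) :=
  (u.memLp_grad i j).mono_measure (Measure.restrict_mono Rm1_subset_R le_rfl)

/-- The gradient of the reflection of `u`. -/
def reflGrad (u : W12 R) (x : Plane) (i j : Fin 2) : ℝ := reflSign j * u.grad (refl x) i j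

theorem memLp_reflGrad (u : W12 R) (i j : Fin 2) :
    MemLp (fun x => reflGrad u x i j) 2 (volume.restrict Rm2) :=
  ((memLp_grad_Rm1 u i j).comp_measurePreserving measurePreserving_refl_restrict).const_mul _

theorem integrable_normSq {u : W12 R} {s : Set Plane} (hs : s ⊆ R) :
    IntegrableOn (fun x => normSq (u.grad x)) s := by
  refine IntegrableOn.mono_set ?_ hs
  unfold normSq
  exact integrable_finsetSum _ fun i _ => integrable_finsetSum _ fun j _ =>
    (u.memLp_grad i j).integrable_sq

theorem integrable_det (u : W12 R) : IntegrableOn (fun x => (u.grad x).det) Rm2 := by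
  simp only [Matrix.det_fin_two]
  exact ((memLp_grad_Rm2 u 0 0).integrable_mul (memLp_grad_Rm2 u 1 1)).sub
    ((memLp_grad_Rm2 u 0 1).integrable_mul (memLp_grad_Rm2 u 1 0))

theorem dirichlet_eq_add (u : W12 R) :
    dirichlet u = (∫ x in Rm2, normSq (u.grad x)) + ∫ x in Rm1, normSq (u.grad x) := by
  rw [dirichlet, ← setIntegral_congr_set Rm2_union_Rm1_ae_eq,
    setIntegral_union disjoint_Rm2_Rm1 (measurableSet_rect _ _ _ _)
      (integrable_normSq Rm2_subset_R) (integrable_normSq Rm1_subset_R)]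

theorem integral_normSq_refl (u : W12 R) :
    ∫ x in Rm2, normSq (u.grad (refl x)) = ∫ x in Rm1, normSq (u.grad x) :=
  measurePreserving_refl_restrict.integral_comp measurableEmbedding_refl
    fun x => normSq (u.grad x)

/-- The rows of `∇u` are orthogonal to the rotated gradients of the difference of `u` and its
reflection. -/
theorem integral_jacobian_sub_reflGrad {u : W12 R} (hu : u ∈ U₀) (i k : Fin 2) :
    (∫ x in Rm2, u.grad x i 0 * (u.grad x k 1 - reflGrad u x k 1)) -
      ∫ x in Rm2, u.grad x i 1 * (u.grad x k 0 - reflGrad u x k 0) = 0 := by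
  obtain ⟨-, v, hv, -, hgrad, htr⟩ := hu
  have hvi (n : ℕ) (i : Fin 2) : ContDiff ℝ ∞ fun x => v n x i := contDiff_euclidean.1 (hv n) i
  have hmono {s : Set Plane} (hs : s ⊆ R) (i j : Fin 2) :
      Tendsto (fun n => eLpNorm (fun x => pderiv (fun y => v n y i) j x - u.grad x i j) 2
        (volume.restrict s)) atTop (𝓝 0) :=
    tendsto_of_tendsto_of_tendsto_of_le_of_le tendsto_const_nhds (hgrad i j)
      (fun _ => zero_le) fun n => eLpNorm_mono_measure _ (Measure.restrict_mono hs le_rfl)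
  refine integral_jacobian_eq_zero (f := fun n x => v n x i)
    (g := fun n x => v n x k - v n (refl x) k) (F := fun j x => u.grad x i j)
    (K := fun j x => u.grad x k j - reflGrad u x k j) (fun n => hvi n i)
    (fun n => (hvi n k).sub ((hvi n k).comp contDiff_refl)) (fun j => memLp_grad_Rm2 u i j)
    (fun j => (memLp_grad_Rm2 u k j).sub (memLp_reflGrad u k j))
    (fun j => hmono Rm2_subset_R i j) (fun j => ?_) ?_ fun n t => ?_
  -- The gradient error of the difference is at most the error of `v n` on `Rm2` plus the reflected
  -- error, whose norm is the error on `Rm1`.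
  · have hsum := (hmono Rm2_subset_R k j).add (hmono Rm1_subset_R k j)
    rw [add_zero] at hsum
    refine tendsto_of_tendsto_of_tendsto_of_le_of_le tendsto_const_nhds hsum
      (fun _ => zero_le) fun n => ?_
    have hmeas {s : Set Plane} (hs : MemLp (fun x => u.grad x k j) 2 (volume.restrict s)) :
        AEStronglyMeasurable (fun x => pderiv (fun y => v n y k) j x - u.grad x k j)
          (volume.restrict s) :=
      (contDiff_pderiv (hvi n k) j).continuous.aestronglyMeasurable.sub hs.1
    have hm1 := hmeas (memLp_grad_Rm1 u k j)
    have hm2 := hmeas (memLp_grad_Rm2 u k j)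
    have hm1' := (hm1.comp_measurePreserving measurePreserving_refl_restrict).const_mul
      (reflSign j)
    have hsplit : (fun x => pderiv (fun y => v n y k - v n (refl y) k) j x -
          (u.grad x k j - reflGrad u x k j)) =
        (fun x => pderiv (fun y => v n y k) j x - u.grad x k j) -
          fun x => reflSign j *
            ((fun x => pderiv (fun y => v n y k) j x - u.grad x k j) ∘ refl) x := by
      ext x
      have hd : pderiv (fun y => v n y k - v n (refl y) k) j x =
          pderiv (fun y => v n y k) j x - pderiv (fun y => v n (refl y) k) j x := by
        exact congrArg (· (EuclideanSpace.single j 1))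
          (fderiv_fun_sub ((hvi n k).differentiable (by simp) x)
            (((hvi n k).comp contDiff_refl).differentiable (by simp) x))
      simp only [hd, pderiv_comp_refl (hvi n k), reflGrad, Pi.sub_apply, Function.comp_apply]
      ring
    rw [hsplit]
    refine (eLpNorm_sub_le hm2 hm1' one_le_two).trans (add_le_add le_rfl (le_of_eq ?_))
    rw [← eLpNorm_comp_measurePreserving hm1 measurePreserving_refl_restrict]
    refine eLpNorm_congr_norm_ae (Eventually.of_forall fun x => ?_)
    rw [norm_mul, Real.norm_eq_abs (reflSign j), abs_reflSign, one_mul]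
  · refine tendsto_of_tendsto_of_tendsto_of_le_of_le tendsto_const_nhds htr
      (fun _ => zero_le) fun n => eLpNorm_mono fun x => ?_
    simpa using PiLp.norm_apply_le (v n x) i
  -- Points of the common edge are fixed by the reflection, so each smooth approximant of `u - ũ`
  -- vanishes there exactly.
  · have : refl (mk (-1 / 2, t)) = mk (-1 / 2, t) := by
      rw [refl, mk_apply_zero, mk_apply_one]
      norm_num
    simp [this]

theorem four_mul_integral_det_le_dirichlet {u : W12 R} (hu : u ∈ U₀) :
    4 * ∫ x in Rm2, (u.grad x).det ≤ dirichlet u := by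
  have hG := memLp_grad_Rm2 u
  have hK (i j : Fin 2) := (hG i j).sub (memLp_reflGrad u i j)
  have hint (i j k l : Fin 2) : IntegrableOn
      (fun x => u.grad x i j * (u.grad x k l - reflGrad u x k l)) Rm2 :=
    (hG i j).integrable_mul (hK k l)
  have hrefl : IntegrableOn (fun x => normSq (u.grad (refl x))) Rm2 :=
    (measurePreserving_refl_restrict.integrable_comp_emb measurableEmbedding_refl).2
      (integrable_normSq (u := u) Rm1_subset_R)
  have hsq : IntegrableOn (fun x => normSq (u.grad x)) Rm2 := integrable_normSq Rm2_subset_R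
  have h01 := integral_jacobian_sub_reflGrad hu 0 1
  have h10 := integral_jacobian_sub_reflGrad hu 1 0
  rw [← integral_sub (hint _ _ _ _) (hint _ _ _ _)] at h01 h10
  have hJ01 := (hint 0 0 1 1).sub (hint 0 1 1 0)
  have hJ10 := (hint 1 0 0 1).sub (hint 1 1 0 0)
  -- The two null integrals are added in the combination that cancels `4 det ∇u` pointwise, leaving
  -- only products of entries of `∇u` and `∇ũ`.
  have hle := integral_mono ((integrable_det u).const_mul 4)
    (((hJ01.sub hJ10).const_mul 2).add (hsq.add hrefl)) fun x => by
      simp only [Pi.add_apply, Pi.sub_apply, normSq, Fin.sum_univ_two, Matrix.det_fin_two,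
        reflGrad, reflSign, Matrix.cons_val_zero, Matrix.cons_val_one]
      -- The gap between the two sides is exactly the sum of these four squares; their signs reflect
      -- `reflSign`.
      nlinarith [sq_nonneg (u.grad x 0 0 - u.grad (refl x) 1 1),
        sq_nonneg (u.grad x 0 1 - u.grad (refl x) 1 0),
        sq_nonneg (u.grad x 1 0 + u.grad (refl x) 0 1),
        sq_nonneg (u.grad x 1 1 + u.grad (refl x) 0 0)]
  rw [integral_const_mul, integral_add' ((hJ01.sub hJ10).const_mul 2) (hsq.add hrefl),
    integral_add' hsq hrefl, integral_const_mul, integral_sub' hJ01 hJ10] at hle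
  simp only [Pi.sub_apply] at hle
  rw [h01, h10, integral_normSq_refl, ← dirichlet_eq_add] at hle
  linarith

theorem energy_eq (M : ℝ) (u : W12 R) :
    energy M u = dirichlet u - M * ∫ x in Rm2, (u.grad x).det := by
  rw [energy, integral_sub (integrable_normSq Rm2_subset_R) ((integrable_det u).const_mul M),
    integral_const_mul, dirichlet_eq_add]
  ring

theorem le_energy {M : ℝ} (hM : 0 ≤ M) {u : W12 R} (hu : u ∈ U₀) :
    (4 - M) / 4 * dirichlet u ≤ energy M u := by
  rw [energy_eq]
  -- The difference of the two sides is `M / 4` times the slack in the determinant estimate.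
  nlinarith [mul_le_mul_of_nonneg_left (four_mul_integral_det_le_dirichlet hu) hM]

end Insulation

end

theorem mainTheorem3 (M : ℝ) (hM0 : 0 ≤ M) (hM4 : M < 4) :
    (∀ u ∈ Insulation.U₀,
      (4 - M) / 4 * Insulation.dirichlet u ≤ Insulation.energy M u) ∧
    Insulation.MeanCoercive (Insulation.energy M) Insulation.U₀ :=
  ⟨fun _ hu => Insulation.le_energy hM0 hu,
    (4 - M) / 4, by linarith, fun _ hu => Insulation.le_energy hM0 hu⟩
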